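/- Let $H=(h_{ji})_{j\in J,\,i\in I}$ be a binary matrix with finite index sets such that every column contains exactly two ones, i.e. $H$ is a parity-check matrix of a cycle code $C$; put $I_j=\{i : h_{ji}=1\}$. The Tanner graph $T(H)$ has bit nodes $i\in I$ and check nodes $j\in J$, with $i$ adjacent to $j$ iff $h_{ji}=1$. The normal graph $N=N(H)$ has vertex set $J$ and, for each $i\in I$, one edge $e_i$ joining the two checks $j$ with $h_{ji}=1$. For $M\ge 1$, an $M$-cover of $T(H)$ is a graph $\widetilde T$ with a surjective graph homomorphism $\pi:\widetilde T\to T(H)$ that maps the neighbourhood of each vertex $y$ bijectively to the neighbourhood of $\pi(y)$ and all of whose fibres have exactly $M$ elements. A codeword $\tilde c$ of $\widetilde T$ assigns a value in $\mathbb F_2$ to each vertex over a bit node so that the values at the neighbours of each vertex over a check node sum to $0$. A vector $p\in\mathbb N_0^I$ is an unscaled pseudo-codeword of $C$ if for some $M\ge1$, some $M$-cover and some codeword $\tilde c$, each $p_i$ is the integer sum of the values of $\tilde c$ over the fibre of the bit node $i$. A cycle in $N$ is a nonempty edge sequence $\Gamma=(e_{i_1},\dots,e_{i_k})$ whose edges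 can be directed so that each terminates where the next begins and the last terminates where the first begins. It is backtrackless if $e_{i_s}\ne e_{i_{s+1}}$ for $1\le s<k$, tailless if $e_{i_1}\neq e_{i_k}$, and primitive if it is not $\Theta^r$ for a cycle $\Theta$ and $r\ge2$. Let $A(N)$ be the set of classes, up to cyclic rotation, of backtrackless tailless primitive cycles, let $g(\Gamma)=u_{i_1}\cdots u_{i_k}$, and let $$\zeta_N=\prod_{[\Gamma]\in A(N)}\bigl(1-g(\Gamma)\bigr)^{-1}\in\mathbb Z[[u_i : i\in I]].$$ The fundamental cone $\mathcal K(H)\subseteq\mathbb R^I$ is the set of all $\omega$ with $\omega_i\ge0$ for all $i\in I$ and $\sum_{i'\in I_j\setminus\{i\}}\omega_{i'}\ge\omega_i$ for all $j\in J$ and $i\in I_j$. Then: 1. A vector $p\in\mathbb N_0^I$ is an unscaled pseudo-codeword of $C$ if and only if there is a combination (a finite, possibly empty collection, repetitions allowed) of backtrackless tailless cycles in $N$ that together use the edge $e_i$ exactly $p_i$ times for every $i\in I$. Moreover, there is a single backtrackless tailless cycle in $N$ that uses each edge $e_i$ exactly $p_i$ times if and only if $p$ is an unscaled pseudo-codeword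 whose support $\{e_i : p_i>0\}$ is nonempty and connected. 2. The product that defines $\zeta_N$ converges (coefficientwise), and $p\mapsto\prod_{i}u_i^{p_i}$ is a bijection from the set of unscaled pseudo-codewords of $C$ onto the set of monomials that have nonzero coefficient in $\zeta_N$. 3. The Newton polyhedron of $\zeta_N$, i.e. the convex hull in $\mathbb R^I$ of the exponent vectors of the monomials with nonzero coefficient in $\zeta_N$, equals $\mathcal K(H)$. -/

import Mathlib

open scoped MvPowerSeries.WithPiTopology

namespace CycleCode

noncomputable section

/-! ### Parity-check matrices, Tanner graphs, cycle codes

Rows of `H` (checks) are indexed by `J`, columns of `H` (bits) are indexed by `I`. -/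

section Codes

variable {J I : Type*}

/-- The set `J_i` of the checks in which the bit `i` takes part. -/
def checksOf (H : Matrix J I (ZMod 2)) (i : I) : Set J := {j | H j i = 1}

/-- A cycle code: every bit takes part in exactly two checks. -/
def IsCycleCode (H : Matrix J I (ZMod 2)) : Prop := ∀ i, (checksOf H i).ncard = 2

/-- The Tanner graph: bit node `i` and check node `j` are adjacent iff `H j i = 1`. -/
def tannerGraph (H : Matrix J I (ZMod 2)) : SimpleGraph (I ⊕ J) where
  Adj
    | .inl i, .inr j => H j i = 1
    | .inr j, .inl i => H j i = 1
    | _, _ => False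
  symm := ⟨by rintro (i | j) (i' | j') h <;> exact h⟩
  loopless := ⟨by rintro (i | j) h <;> exact h⟩

/-- The normal graph: its vertices are the checks, and every bit `i` of degree two is an edge,
labelled `i`, that joins the two checks in which `i` takes part. -/
def normalGraph (H : Matrix J I (ZMod 2)) : Graph J I where
  vertexSet := Set.univ
  IsLink i a b := a ≠ b ∧ checksOf H i = {a, b}
  isLink_symm := fun _ _ => ⟨fun _ _ h => ⟨h.1.symm, h.2.trans (Set.pair_comm _ _)⟩⟩
  eq_or_eq_of_isLink_of_isLink := by
    rintro e x y v w ⟨-, h⟩ ⟨-, h'⟩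
    have hx : x ∈ ({v, w} : Set J) := by rw [← h', h]; exact Set.mem_insert _ _
    simpa using hx
  left_mem_of_isLink := fun _ _ _ _ => Set.mem_univ _

end Codes

/-! ### Covers and pseudo-codewords -/

section Covers

variable {V W : Type*} {X : SimpleGraph V} {Y : SimpleGraph W}

/-- An (unramified) cover of graphs: a surjective graph homomorphism that maps the neighbourhood
of each vertex `y` bijectively to the neighbourhood of the image of `y`. -/
def IsCover (π : Y →g X) : Prop :=
  Function.Surjective π ∧ ∀ y, Set.BijOn π (Y.neighborSet y) (X.neighborSet (π y))

/-- An `M`-cover: a cover all of whose fibres have exactly `M` elements. -/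
def IsMCover (M : ℕ) (π : Y →g X) : Prop :=
  IsCover π ∧ ∀ x, Finite (π ⁻¹' {x}) ∧ (π ⁻¹' {x}).ncard = M

end Covers

section PseudoCodewords

variable {J I W : Type*} {H : Matrix J I (ZMod 2)} {Y : SimpleGraph W}

/-- The bit nodes of a graph lying over a Tanner graph. -/
abbrev BitNode (π : Y →g tannerGraph H) : Type _ := {w : W // ∃ i, π w = Sum.inl i}

open scoped Classical in
/-- `c` is a codeword of the binary code described by a graph over the Tanner graph: for each of
its check nodes `w`, the values of `c` at the bit nodes adjacent to `w` sum to zero in `GF(2)`. -/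
def IsCoverCodeword [Fintype W] (π : Y →g tannerGraph H) (c : BitNode π → ZMod 2) : Prop :=
  ∀ (w : W) (j : J), π w = Sum.inr j → ∑ x ∈ Finset.univ.filter (fun x : BitNode π => Y.Adj w x.1), c x = 0

open scoped Classical in
/-- The unscaled pseudo-codeword of `c`: its entry `i` is the sum, taken over the integers, of the
values of `c` at the copies of the bit node `i`. -/
def unscaledPseudoCodeword [Fintype W] (π : Y →g tannerGraph H) (c : BitNode π → ZMod 2) (i : I) :
    ℕ :=
  ∑ x ∈ Finset.univ.filter (fun x : BitNode π => π x.1 = Sum.inl i), (c x).val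

/-- `p` is the unscaled pseudo-codeword of some codeword in the code described by some `M`-cover
of the Tanner graph of `H`, for some positive integer `M`. -/
def IsUnscaledPseudoCodeword (H : Matrix J I (ZMod 2)) (p : I → ℕ) : Prop :=
  ∃ (M : ℕ) (W : Type) (_ : Fintype W) (Y : SimpleGraph W) (π : Y →g tannerGraph H)
    (c : BitNode π → ZMod 2),
    0 < M ∧ IsMCover M π ∧ IsCoverCodeword π c ∧ ∀ i, p i = unscaledPseudoCodeword π c i

end PseudoCodewords

/-! ### The fundamental cone -/

section Cone

variable {J I : Type*}

open scoped Classical in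
/-- The fundamental cone of `H`. -/
def fundamentalCone [Fintype I] (H : Matrix J I (ZMod 2)) : Set (I → ℝ) :=
  {ω | (∀ i, 0 ≤ ω i) ∧
    ∀ j i, H j i = 1 → ω i ≤ ∑ i' : I with H j i' = 1 ∧ i' ≠ i, ω i'}

end Cone

/-! ### Cycles in graphs and the edge zeta function -/

section Zeta

variable {V E : Type*}

/-- A nonempty sequence of edges is a cycle if its edges can be directed so that each one
terminates where the next one begins, and the last one terminates where the first one begins. -/
def IsCycle (G : Graph V E) (γ : List E) : Prop :=
  γ ≠ [] ∧ ∃ v : Fin (γ.length + 1) → V, v (Fin.last _) = v 0 ∧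
    ∀ s : Fin γ.length, G.IsLink (γ.get s) (v s.castSucc) (v s.succ)

/-- No edge is immediately followed by itself. -/
def IsBacktrackless (γ : List E) : Prop := γ.IsChain (· ≠ ·)

/-- The first edge is different from the last one. -/
def IsTailless (γ : List E) : Prop := γ.head? ≠ γ.getLast?

/-- A backtrackless tailless cycle. -/
def IsBTCycle (G : Graph V E) (γ : List E) : Prop :=
  IsCycle G γ ∧ IsBacktrackless γ ∧ IsTailless γ

/-- The sequence is not obtained by following some cycle `r ≥ 2` times. -/
def IsPrimitive (G : Graph V E) (γ : List E) : Prop :=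
  ¬ ∃ (θ : List E) (r : ℕ), IsCycle G θ ∧ 2 ≤ r ∧ γ = (List.replicate r θ).flatten

/-- The set of equivalence classes, under cyclic rotation, of backtrackless tailless primitive
cycles. (The type `Cycle E` consists of the lists in `E` up to rotation.) -/
def primeClasses (G : Graph V E) : Set (Cycle E) :=
  {c | ∃ γ : List E, (γ : Cycle E) = c ∧ IsBTCycle G γ ∧ IsPrimitive G γ}

/-- The monomial of a cycle: the product of the indeterminates of its edges. -/
def cycleMonomial (c : Cycle E) : MvPowerSeries E ℤ :=
  (c.toMultiset.map fun e => (MvPowerSeries.X e : MvPowerSeries E ℤ)).prod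

/-- The factor `(1 - g(Γ))⁻¹` of the edge zeta function, as a formal power series. -/
def zetaFactor (G : Graph V E) (c : primeClasses G) : MvPowerSeries E ℤ :=
  MvPowerSeries.invOfUnit (1 - cycleMonomial c.1) 1

/-- The edge zeta function: the product is taken in the ring of formal power series, for the
topology of coefficientwise convergence. -/
def edgeZeta (G : Graph V E) : MvPowerSeries E ℤ := ∏' c : primeClasses G, zetaFactor G c

/-- The Newton polyhedron of a power series: the convex hull of the exponent vectors of its
terms with nonzero coefficient. -/
def newtonPolyhedron (f : MvPowerSeries E ℤ) : Set (E → ℝ) :=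
  convexHull ℝ {x | ∃ m : E →₀ ℕ, MvPowerSeries.coeff m f ≠ 0 ∧ x = fun e => (m e : ℝ)}

/-- The set `S` of edges is nonempty and connected: from each edge of `S` one can get to each other
one through edges of `S`, where successive edges share an end. -/
def IsConnectedEdgeSet (G : Graph V E) (S : Set E) : Prop :=
  S.Nonempty ∧ ∀ e ∈ S, ∀ f ∈ S,
    Relation.ReflTransGen (fun a b => b ∈ S ∧ ∃ v, G.Inc a v ∧ G.Inc b v) e f

end Zeta

end

end CycleCode

/-! Everything reduces to one local condition on `p`, called `IsBalanced`: at every check the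
incident multiplicities have even sum, and none exceeds the sum of the others.

Pseudo-codewords: each copy of a check sees a 0-1 vector of even weight, and sums of such vectors
are balanced. Conversely, a balanced `p` splits at each check into `M` even subsets
(`Balanced.exists_even_family`); permutation voltages glue these local choices into an `M`-cover.

Cycles: each passage through a vertex uses two distinct edges, so edge counts are balanced.
Conversely, a walk can be continued by pairing its last edge with another one
(`Balanced.exists_remove_pair`) until it closes up, and what is left over is again balanced. Cycles
that meet can be merged, so a connected support needs only one.

Zeta function: the factors are geometric series with nonnegative coefficients, so nothing cancels.
The support is the monoid generated by the prime cycles, hence by all backtrackless tailless cycles,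
and consists of the balanced vectors.

Newton polyhedron: the real form of the balance inequalities defines the cone. A rational point of
the cone has a balanced multiple, and a cone with rational inequalities is the convex hull of its
rational points. -/

namespace CycleCode

/-! ### Balanced multiplicities at one vertex -/

section Balanced

variable {E : Type*}

/-- The multiplicities `d` on `s` have even sum, and none exceeds the sum of the others. -/
def Balanced (s : Finset E) (d : E → ℕ) : Prop :=
  Even (∑ i ∈ s, d i) ∧ ∀ i ∈ s, 2 * d i ≤ ∑ k ∈ s, d k

theorem Balanced.zero (s : Finset E) : Balanced s (fun _ => 0) := by simp [Balanced]

theorem Balanced.congr {s : Finset E} {d d' : E → ℕ} (h : Balanced s d)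
    (hd : ∀ i ∈ s, d' i = d i) : Balanced s d' := by
  refine ⟨by rw [Finset.sum_congr rfl hd]; exact h.1, fun i hi => ?_⟩
  rw [Finset.sum_congr rfl hd, hd i hi]; exact h.2 i hi

theorem Balanced.add {s : Finset E} {d d' : E → ℕ} (h : Balanced s d) (h' : Balanced s d') :
    Balanced s (fun i => d i + d' i) := by
  refine ⟨by rw [Finset.sum_add_distrib]; exact h.1.add h'.1, fun i hi => ?_⟩
  rw [Finset.sum_add_distrib]
  have := h.2 i hi
  have := h'.2 i hi
  change 2 * (d i + d' i) ≤ _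
  omega

theorem sum_add_pair [DecidableEq E] {s : Finset E} (d : E → ℕ) {a b : E} (ha : a ∈ s) (hb : b ∈ s) :
    ∑ i ∈ s, (d i + (if i = a then 1 else 0) + (if i = b then 1 else 0)) = ∑ i ∈ s, d i + 2 := by
  rw [Finset.sum_add_distrib, Finset.sum_add_distrib]
  simp [ha, hb]

/-- The sum grows by 2, while each single multiplicity grows by at most 1 because `a ≠ b`. -/
theorem Balanced.add_pair [DecidableEq E] {s : Finset E} {d : E → ℕ} (h : Balanced s d) {a b : E} (ha : a ∈ s)
    (hb : b ∈ s) (hab : a ≠ b) :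
    Balanced s (fun i => d i + (if i = a then 1 else 0) + (if i = b then 1 else 0)) := by
  refine ⟨by rw [sum_add_pair d ha hb]; exact h.1.add even_two, fun i hi => ?_⟩
  rw [sum_add_pair d ha hb]
  have := h.2 i hi
  beta_reduce
  split_ifs <;> first | omega | (subst_vars; exact absurd rfl hab)

/-- The partner `f` is an edge of largest multiplicity among those other than `e`; any other choice
could leave a multiplicity that exceeds the sum of the rest. -/
theorem Balanced.exists_remove_pair [DecidableEq E] {s : Finset E} {d : E → ℕ} (h : Balanced s d) {e : E}
    (he : e ∈ s) (hd : 0 < d e) :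
    ∃ f ∈ s, f ≠ e ∧ 0 < d f ∧ ∃ d' : E → ℕ, Balanced s d' ∧
      ∀ i, d i = d' i + (if i = e then 1 else 0) + (if i = f then 1 else 0) := by
  have hsum := Finset.add_sum_erase s d he
  have h2 := h.2 e he
  have hne : (s.erase e).Nonempty := by
    by_contra hcon
    rw [Finset.not_nonempty_iff_eq_empty] at hcon
    rw [hcon, Finset.sum_empty] at hsum
    omega
  obtain ⟨f, hf, hmax⟩ := Finset.exists_max_image (s.erase e) d hne
  have hfe : f ≠ e := Finset.ne_of_mem_erase hf
  have hfs : f ∈ s := Finset.mem_of_mem_erase hf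
  have hfpos : 0 < d f := by
    by_contra hcon
    have : ∑ i ∈ s.erase e, d i = 0 := Finset.sum_eq_zero fun i hi => by
      have := hmax i hi
      omega
    omega
  have hdec : ∀ i, d i = (d i - (if i = e then 1 else 0) - (if i = f then 1 else 0)) +
      (if i = e then 1 else 0) + (if i = f then 1 else 0) := by
    intro i
    by_cases h1 : i = e
    · subst h1
      simp [hfe.symm]
      omega
    · by_cases h2 : i = f
      · subst h2
        simp [h1]
        omega
      · simp [h1, h2]
  obtain ⟨d', hdec⟩ : ∃ d' : E → ℕ,
      ∀ i, d i = d' i + (if i = e then 1 else 0) + (if i = f then 1 else 0) := ⟨_, hdec⟩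
  refine ⟨f, hfs, hfe, hfpos, d', ?_, hdec⟩
  have hS : ∑ i ∈ s, d i = ∑ i ∈ s, d' i + 2 :=
    (Finset.sum_congr rfl fun i _ => hdec i).trans (sum_add_pair d' he hfs)
  obtain ⟨k, hk⟩ := h.1
  refine ⟨⟨k - 1, by omega⟩, fun c hc => ?_⟩
  have hc2 := h.2 c hc
  have hcd := hdec c
  by_cases h1 : c = e
  · simp only [h1, if_true, if_neg hfe.symm] at hcd hc2 ⊢
    omega
  · by_cases h3 : c = f
    · simp only [h3, if_true, if_neg hfe] at hcd hc2 ⊢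
      omega
    -- Here the sum is at least `d e + d f + d c ≥ 1 + 2 * d c`; being even, it is at least `2 * d c
    -- + 2`.
    · have hcs : c ∈ s.erase e := Finset.mem_erase.2 ⟨h1, hc⟩
      have hcf := hmax c hcs
      have hsum2 := Finset.add_sum_erase (s.erase e) d hf
      have hle : d c ≤ ∑ i ∈ (s.erase e).erase f, d i :=
        Finset.single_le_sum (f := d) (fun _ _ => Nat.zero_le _)
          (Finset.mem_erase.2 ⟨h3, hcs⟩)
      simp only [h1, h3, if_false] at hcd ⊢
      omega

/-- Balanced multiplicities are the multiplicities of a family of even subsets. -/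
theorem Balanced.exists_even_family [DecidableEq E] (s : Finset E) :
    ∀ (n : ℕ) (d : E → ℕ), ∑ i ∈ s, d i = n → Balanced s d →
    ∃ N : ℕ, ∀ M, N ≤ M → ∃ T : Fin M → Finset E, (∀ t, T t ⊆ s ∧ Even (T t).card) ∧
      ∀ i ∈ s, ∑ t, (if i ∈ T t then 1 else 0) = d i := by
  intro n
  induction n using Nat.strong_induction_on with
  | _ n ih =>
    intro d hn hd
    by_cases h0 : ∀ i ∈ s, d i = 0
    -- Spare indices receive the empty set, so every large `M` works and one `M` can serve all
    -- checks.
    · exact ⟨0, fun M _ => ⟨fun _ => ∅, by simp, fun i hi => by simp [h0 i hi]⟩⟩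
    · push Not at h0
      obtain ⟨e, he, hde⟩ := h0
      obtain ⟨f, hf, hfe, -, d', hd', hdd'⟩ := hd.exists_remove_pair he (Nat.pos_of_ne_zero hde)
      have hS : ∑ i ∈ s, d i = ∑ i ∈ s, d' i + 2 :=
        (Finset.sum_congr rfl fun i _ => hdd' i).trans (sum_add_pair d' he hf)
      obtain ⟨N, hN⟩ := ih (∑ i ∈ s, d' i) (by omega) d' rfl hd'
      refine ⟨N + 1, fun M hM => ?_⟩
      obtain ⟨M, rfl⟩ : ∃ M', M = M' + 1 := ⟨M - 1, by omega⟩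
      obtain ⟨T, hT, hT'⟩ := hN M (by omega)
      refine ⟨Fin.cons {e, f} T, fun t => ?_, fun i hi => ?_⟩
      · refine Fin.cases ?_ (fun t => ?_) t
        · simp only [Fin.cons_zero]
          refine ⟨by simp [Finset.insert_subset_iff, he, hf], ?_⟩
          rw [Finset.card_pair hfe.symm]
          exact even_two
        · simpa using hT t
      · rw [Fin.sum_univ_succ]
        simp only [Fin.cons_zero, Fin.cons_succ, hT' i hi, hdd' i, Finset.mem_insert,
          Finset.mem_singleton]
        by_cases h1 : i = e
        · subst h1
          simp [hfe.symm]
          omega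
        · by_cases h2 : i = f
          · subst h2
            simp [h1]
            omega
          · simp [h1, h2]

end Balanced

/-! ### Walks, and balanced multiplicities as edge counts of cycles -/

section Walks

variable {V E : Type*} {G : Graph V E}

/-- The edges in `l` lead from `u` to `v`. -/
def IsWalk (G : Graph V E) : V → List E → V → Prop
  | u, [], v => u = v
  | u, e :: l, v => ∃ x, G.IsLink e u x ∧ IsWalk G x l v

theorem isWalk_append {u v : V} {l l' : List E} :
    IsWalk G u (l ++ l') v ↔ ∃ x, IsWalk G u l x ∧ IsWalk G x l' v := by
  induction l generalizing u with
  | nil => simp [IsWalk]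
  | cons e l ih =>
    simp only [List.cons_append, IsWalk, ih]
    constructor
    · rintro ⟨x, hx, y, hy, hy'⟩
      exact ⟨y, ⟨x, hx, hy⟩, hy'⟩
    · rintro ⟨y, ⟨x, hx, hy⟩, hy'⟩
      exact ⟨x, hx, y, hy, hy'⟩

theorem isWalk_singleton {u v : V} {e : E} : IsWalk G u [e] v ↔ G.IsLink e u v := by
  simp [IsWalk]

theorem IsWalk.reverse {u v : V} {l : List E} (h : IsWalk G u l v) : IsWalk G v l.reverse u := by
  induction l generalizing u with
  | nil => exact Eq.symm h
  | cons e l ih =>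
    obtain ⟨x, hx, h⟩ := h
    rw [List.reverse_cons, isWalk_append]
    exact ⟨x, ih h, isWalk_singleton.2 hx.symm⟩

theorem isWalk_iff_exists {u v : V} {l : List E} :
    IsWalk G u l v ↔ ∃ w : Fin (l.length + 1) → V, w 0 = u ∧ w (Fin.last _) = v ∧
      ∀ s : Fin l.length, G.IsLink (l.get s) (w s.castSucc) (w s.succ) := by
  induction l generalizing u with
  | nil =>
    constructor
    · rintro rfl
      exact ⟨fun _ => u, rfl, rfl, fun s => s.elim0⟩
    · rintro ⟨w, h0, h1, -⟩
      exact h0.symm.trans h1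
  | cons e l ih =>
    constructor
    · rintro ⟨x, hx, h⟩
      obtain ⟨w, h0, h1, hw⟩ := ih.1 h
      refine ⟨Fin.cons u w, rfl, by simpa [← Fin.succ_last] using h1, fun s => ?_⟩
      refine Fin.cases ?_ (fun t => ?_) s
      · simpa [h0] using hx
      · simpa using hw t
    · rintro ⟨w, h0, h1, hw⟩
      refine ⟨w 1, ?_, ih.2 ⟨Fin.tail w, rfl, ?_, fun s => ?_⟩⟩
      · simpa [h0] using hw 0
      · rw [← h1]
        rfl
      · exact hw s.succ

theorem isCycle_iff {γ : List E} : IsCycle G γ ↔ γ ≠ [] ∧ ∃ u, IsWalk G u γ u := by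
  refine and_congr_right fun _ => ?_
  constructor
  · rintro ⟨v, h1, h2⟩
    exact ⟨v 0, isWalk_iff_exists.2 ⟨v, rfl, h1, h2⟩⟩
  · rintro ⟨u, h⟩
    obtain ⟨v, h0, h1, h2⟩ := isWalk_iff_exists.1 h
    exact ⟨v, h1.trans h0.symm, h2⟩

theorem isBTCycle_iff {γ : List E} : IsBTCycle G γ ↔
    (∃ u, IsWalk G u γ u) ∧ γ.IsChain (· ≠ ·) ∧ γ.head? ≠ γ.getLast? := by
  unfold IsBTCycle IsBacktrackless IsTailless
  rw [isCycle_iff]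
  refine and_congr_left fun h => and_iff_right ?_
  -- Both ends of the empty list are `none`, so taillessness already excludes it.
  rintro rfl
  simp at h

/-- Distributes one use of an edge over its two ends; these differ because there are no loops. -/
theorem indicator_inc [DecidableEq V] [DecidableEq E] (hG : ∀ e x, ¬ G.IsLink e x x) {e i : E}
    {u x j : V} (h : G.IsLink e u x) (hi : G.Inc i j) : (if i = e then 1 else 0) =
      (if j = u ∧ i = e then 1 else 0) + (if j = x ∧ i = e then 1 else 0) := by
  by_cases hie : i = e
  · subst hie
    have hux : u ≠ x := fun hux => hG i u (by rwa [← hux] at h)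
    rcases hi.eq_or_eq_of_isLink h with rfl | rfl
    · simp [hux]
    · simp [hux.symm]
  · simp [hie]

theorem IsWalk.inc_getLast {u v : V} {l : List E} {e : E} (h : IsWalk G u l v)
    (he : l.getLast? = some e) : G.Inc e v := by
  rw [List.getLast?_eq_some_iff] at he
  obtain ⟨l', rfl⟩ := he
  obtain ⟨x, -, hx⟩ := isWalk_append.1 h
  exact (isWalk_singleton.1 hx).inc_right

theorem IsWalk.inc_head {u v : V} {l : List E} {e : E} (h : IsWalk G u l v)
    (he : l.head? = some e) : G.Inc e u :=
  h.reverse.inc_getLast (by simpa using he)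

variable [Fintype E]

open scoped Classical in
/-- The edges incident with a vertex. -/
noncomputable def edgesAt (G : Graph V E) (j : V) : Finset E := Finset.univ.filter (G.Inc · j)

theorem mem_edgesAt {j : V} {i : E} : i ∈ edgesAt G j ↔ G.Inc i j := by simp [edgesAt]

/-- Multiplicities of edges that are balanced at every vertex. -/
def IsBalanced (G : Graph V E) (p : E → ℕ) : Prop := ∀ j, Balanced (edgesAt G j) p

/-- Each interior visit to `j` pairs two successive edges, distinct since the walk does not
backtrack. Only the first edge (at `u`) and the last one (at `v`) stay unpaired. -/
theorem exists_balanced_of_isWalk [DecidableEq V] [DecidableEq E] (hG : ∀ e x, ¬ G.IsLink e x x)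
    (j v : V) (e : E) (l : List E) :
    ∀ (e₀ : E) (u : V), IsWalk G u (e₀ :: l) v → (e₀ :: l).IsChain (· ≠ ·) →
    (e₀ :: l).getLast? = some e →
    ∃ d, Balanced (edgesAt G j) d ∧ ∀ i ∈ edgesAt G j, (e₀ :: l).count i =
      d i + (if j = u ∧ i = e₀ then 1 else 0) + (if j = v ∧ i = e then 1 else 0) := by
  induction l with
  | nil =>
    intro e₀ u h _ he
    obtain rfl : e₀ = e := by simpa using he
    rw [isWalk_singleton] at h
    refine ⟨fun _ => 0, Balanced.zero _, fun i hi => ?_⟩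
    rw [zero_add, ← indicator_inc hG h (mem_edgesAt.1 hi)]
    rw [List.count_singleton]
    simp only [beq_iff_eq, eq_comm (a := e₀)]
  | cons e₁ l ih =>
    rintro e₀ u ⟨x, hx, h⟩ hc he
    obtain ⟨d, hd, hd'⟩ := ih e₁ x h hc.tail (by simpa using he)
    have hne : e₀ ≠ e₁ := by
      rw [List.isChain_cons_cons] at hc
      exact hc.1
    have hind := fun i hi => indicator_inc (i := i) (j := j) hG hx hi
    by_cases hj : j = x
    · subst hj
      refine ⟨_, hd.add_pair (mem_edgesAt.2 hx.inc_right) (mem_edgesAt.2 (h.inc_head rfl)) hne,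
        fun i hi => ?_⟩
      have h1 := hind i (mem_edgesAt.1 hi)
      have h2 := hd' i hi
      rw [List.count_cons, h2]
      simp only [beq_iff_eq, eq_comm (a := e₀), true_and] at h1 ⊢
      omega
    · refine ⟨d, hd, fun i hi => ?_⟩
      have h1 := hind i (mem_edgesAt.1 hi)
      have h2 := hd' i hi
      rw [List.count_cons, h2]
      simp only [beq_iff_eq, eq_comm (a := e₀), hj, false_and, if_false] at h1 ⊢
      omega

theorem IsBTCycle.isBalanced [DecidableEq E] (hG : ∀ e x, ¬ G.IsLink e x x) {γ : List E}
    (h : IsBTCycle G γ) : IsBalanced G (fun i => γ.count i) := by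
  classical
  intro j
  obtain ⟨⟨u, hu⟩, hc, ht⟩ := isBTCycle_iff.1 h
  cases γ with
  | nil => simp at ht
  | cons e₀ l =>
    obtain ⟨e, he⟩ : ∃ e, (e₀ :: l).getLast? = some e := ⟨_, List.getLast?_cons⟩
    obtain ⟨d, hd, hd'⟩ := exists_balanced_of_isWalk hG j u e l e₀ u hu hc he
    have hne : e₀ ≠ e := by
      rintro rfl
      exact ht he.symm
    -- At the base point the unpaired first and last edges form one more pair, distinct by
    -- taillessness.
    by_cases hj : j = u
    · subst hj
      refine (hd.add_pair (mem_edgesAt.2 (hu.inc_head rfl)) (mem_edgesAt.2 (hu.inc_getLast he))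
        hne).congr fun i hi => ?_
      simpa only [true_and] using hd' i hi
    · refine hd.congr fun i hi => ?_
      simpa only [hj, false_and, if_false, add_zero] using hd' i hi

theorem IsBalanced.zero : IsBalanced G (fun _ => 0) := fun _ => Balanced.zero _

theorem IsBalanced.of_multiset [DecidableEq E] (hG : ∀ e x, ¬ G.IsLink e x x)
    (Γ : Multiset (List E)) (h : ∀ γ ∈ Γ, IsBTCycle G γ) :
    IsBalanced G (fun i => (Γ.map fun γ => γ.count i).sum) := by
  induction Γ using Multiset.induction_on with
  | empty => simpa using IsBalanced.zero
  | cons γ Γ ih =>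
    intro j
    simpa using ((h γ (by simp)).isBalanced hG j).add
      (ih (fun γ' hγ' => h γ' (Multiset.mem_cons_of_mem hγ')) j)

/-- A walk that is balanced, together with `q`, except at its two ends can be closed up. -/
theorem exists_isBTCycle_of_isWalk [DecidableEq V] [DecidableEq E]
    (hG : ∀ e x, ¬ G.IsLink e x x) (u : V) (e₀ : E) :
    ∀ (n : ℕ) (q : E → ℕ) (v : V) (w : List E) (e : E), ∑ i, q i = n →
    IsWalk G u w v → w.IsChain (· ≠ ·) → w.head? = some e₀ → w.getLast? = some e →
    (∀ j, Balanced (edgesAt G j) (fun i => q i + (if j = v ∧ i = e then 1 else 0) +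
      (if j = u ∧ i = e₀ then 1 else 0))) →
    ∃ (γ : List E) (q' : E → ℕ), IsBTCycle G γ ∧ IsBalanced G q' ∧
      ∀ i, γ.count i + q' i = w.count i + q i := by
  intro n
  induction n using Nat.strong_induction_on with
  | _ n ih =>
    intro q v w e hn hw hc hh hl hb
    have hev : G.Inc e v := hw.inc_getLast hl
    -- `q` is the stock of unused edges. The partner of the last edge `e` at `v` is the candidate
    -- for the next edge.
    obtain ⟨f, hf, hfe, hfpos, d, hd, hd'⟩ :=
      (hb v).exists_remove_pair (mem_edgesAt.2 hev) (by simp)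
    simp only [true_and] at hd'
    -- If the partner is the initial edge at its starting end, the walk is closed and `f ≠ e` is
    -- taillessness. Otherwise `f` comes from the stock, and the walk goes on with a smaller `q`.
    by_cases hclose : v = u ∧ f = e₀
    · obtain ⟨rfl, rfl⟩ := hclose
      refine ⟨w, q, isBTCycle_iff.2 ⟨⟨v, hw⟩, hc, ?_⟩, fun j => ?_, fun i => rfl⟩
      · rw [hh, hl]
        simpa using hfe
      · by_cases hj : j = v
        · subst hj
          refine hd.congr fun i _ => ?_
          have := hd' i
          simp only [true_and] at this
          omega
        · simpa [hj] using hb j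
    · have hqf : 0 < q f := by simpa [hfe, hclose] using hfpos
      obtain ⟨v', hv'⟩ := mem_edgesAt.1 hf
      have hvv' : v ≠ v' := fun h => hG f v (by rwa [← h] at hv')
      obtain ⟨q₁, hq₁⟩ : ∃ q₁ : E → ℕ, ∀ i, q i = q₁ i + (if i = f then 1 else 0) :=
        ⟨fun i => q i - (if i = f then 1 else 0), fun i => by
          by_cases h : i = f
          · subst h
            simp
            omega
          · simp [h]⟩
      have hsum : ∑ i, q i = ∑ i, q₁ i + 1 := by
        rw [Finset.sum_congr rfl fun i _ => hq₁ i, Finset.sum_add_distrib]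
        simp
      obtain ⟨γ, q', hγ, hq', hcount⟩ := ih (∑ i, q₁ i) (by omega) q₁ v' (w ++ [f]) f rfl
        (isWalk_append.2 ⟨v, hw, isWalk_singleton.2 hv'⟩)
        (List.isChain_append.2 ⟨hc, by simp, by
          intro x hx y hy
          rw [hl] at hx
          simp only [Option.mem_def, Option.some.injEq, List.head?_cons] at hx hy
          rw [← hx, ← hy]
          exact hfe.symm⟩)
        (by rw [List.head?_append, hh]; rfl) (by simp) (fun j => by
          by_cases hj : j = v
          · subst hj
            refine hd.congr fun i _ => ?_
            have := hd' i
            have := hq₁ i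
            simp only [hvv', false_and, if_false]
            omega
          · refine (hb j).congr fun i hi => ?_
            have h1 := indicator_inc hG hv' (mem_edgesAt.1 hi)
            have := hq₁ i
            simp only [hj, false_and, if_false] at h1 ⊢
            omega)
      refine ⟨γ, q', hγ, hq', fun i => ?_⟩
      rw [hcount i, List.count_append, hq₁ i]
      simp only [List.count_singleton, beq_iff_eq, eq_comm (a := f)]
      omega

/-- Balanced multiplicities are the edge counts of a combination of cycles. -/
theorem IsBalanced.exists_multiset [DecidableEq E] (hG : ∀ e x, ¬ G.IsLink e x x)
    (hE : ∀ e, ∃ x y, G.IsLink e x y) :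
    ∀ (n : ℕ) (p : E → ℕ), ∑ i, p i = n → IsBalanced G p →
    ∃ Γ : Multiset (List E), (∀ γ ∈ Γ, IsBTCycle G γ) ∧
      ∀ i, p i = (Γ.map fun γ => γ.count i).sum := by
  classical
  intro n
  induction n using Nat.strong_induction_on with
  | _ n ih =>
    intro p hn hp
    by_cases h0 : ∀ i, p i = 0
    · exact ⟨0, by simp, by simpa using h0⟩
    · push Not at h0
      obtain ⟨e, he⟩ := h0
      obtain ⟨u, v, huv⟩ := hE e
      obtain ⟨q, hq⟩ : ∃ q : E → ℕ, ∀ i, p i = q i + (if i = e then 1 else 0) :=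
        ⟨fun i => p i - (if i = e then 1 else 0), fun i => by
          by_cases h : i = e
          · subst h
            simp
            omega
          · simp [h]⟩
      -- The walk to close up is the single edge `e`: one unit of `p e` is attributed to each of its
      -- ends.
      obtain ⟨γ, q', hγ, hq', hcount⟩ := exists_isBTCycle_of_isWalk hG u e _ q v [e] e rfl
        (isWalk_singleton.2 huv) (by simp) rfl rfl (fun j => (hp j).congr fun i hi => by
          have := indicator_inc hG huv (mem_edgesAt.1 hi)
          have := hq i
          omega)
      have hcount' : ∀ i, p i = γ.count i + q' i := fun i => by
        rw [hcount i, hq i]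
        simp only [List.count_singleton, beq_iff_eq, eq_comm (a := e)]
        omega
      have hpos : 0 < ∑ i, γ.count i := by
        obtain ⟨x, hx⟩ := List.exists_mem_of_ne_nil γ hγ.1.1
        exact Finset.sum_pos' (fun _ _ => Nat.zero_le _)
          ⟨x, Finset.mem_univ _, List.count_pos_iff.2 hx⟩
      have hsum : ∑ i, p i = ∑ i, γ.count i + ∑ i, q' i := by
        rw [← Finset.sum_add_distrib]
        exact Finset.sum_congr rfl fun i _ => hcount' i
      obtain ⟨Γ, hΓ, hΓ'⟩ := ih (∑ i, q' i) (by omega) q' rfl hq'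
      refine ⟨γ ::ₘ Γ, fun γ' hγ' => ?_, fun i => ?_⟩
      · rcases Multiset.mem_cons.1 hγ' with rfl | h
        exacts [hγ, hΓ _ h]
      · rw [hcount' i, hΓ' i]
        simp

end Walks

/-! ### Merging cycles, and connected supports -/

section Merge

variable {V E : Type*} {G : Graph V E}

theorem IsWalk.isBTCycle_append {j : V} {a b : List E} (ha : IsWalk G j a j) (hb : IsWalk G j b j)
    (hca : a.IsChain (· ≠ ·)) (hcb : b.IsChain (· ≠ ·)) (ha0 : a ≠ []) (hb0 : b ≠ [])
    (hab : a.getLast? ≠ b.head?) (hba : b.getLast? ≠ a.head?) : IsBTCycle G (a ++ b) := by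
  refine isBTCycle_iff.2 ⟨⟨j, isWalk_append.2 ⟨j, ha, hb⟩⟩, List.isChain_append.2
    ⟨hca, hcb, fun x hx y hy hxy => hab ?_⟩, ?_⟩
  · rw [Option.mem_def] at hx hy
    rw [hx, hy, hxy]
  · rw [List.head?_append_of_ne_nil _ ha0, List.getLast?_append_of_ne_nil _ hb0]
    exact hba.symm

/-- A rotation to the base point `j`: the old taillessness prevents backtracking at the old seam,
and the absence of backtracking at the cut gives the new taillessness. -/
theorem IsBTCycle.exists_perm {γ : List E} (h : IsBTCycle G γ) {e : E} (he : e ∈ γ) {j : V}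
    (hj : G.Inc e j) : ∃ γ' : List E, γ'.Perm γ ∧ IsWalk G j γ' j ∧ γ'.IsChain (· ≠ ·) ∧
      γ'.head? ≠ γ'.getLast? := by
  obtain ⟨⟨u, hu⟩, hc, ht⟩ := isBTCycle_iff.1 h
  have key : ∀ a b : List E, γ = a ++ b → IsWalk G u a j → IsWalk G j b u →
      ∃ γ' : List E, γ'.Perm γ ∧ IsWalk G j γ' j ∧ γ'.IsChain (· ≠ ·) ∧
      γ'.head? ≠ γ'.getLast? := by
    rintro a b rfl ha hb
    refine ⟨b ++ a, List.perm_append_comm, isWalk_append.2 ⟨u, hb, ha⟩, ?_⟩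
    rcases eq_or_ne a [] with rfl | ha0
    · simpa using And.intro hc ht
    rcases eq_or_ne b [] with rfl | hb0
    · simpa using And.intro hc ht
    rw [List.head?_append_of_ne_nil _ ha0, List.getLast?_append_of_ne_nil _ hb0] at ht
    rw [List.head?_append_of_ne_nil _ hb0, List.getLast?_append_of_ne_nil _ ha0]
    obtain ⟨h1, h2, h3⟩ := List.isChain_append.1 hc
    refine ⟨List.isChain_append.2 ⟨h2, h1, fun x hx y hy hxy => ht ?_⟩, fun hcon => ?_⟩
    · rw [Option.mem_def] at hx hy
      rw [hx, hy, hxy]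
    · exact h3 _ (by rw [Option.mem_def, ← hcon, List.head?_eq_some_head hb0]) _
        (List.head?_eq_some_head hb0) rfl
  obtain ⟨a, b, rfl⟩ := List.append_of_mem he
  obtain ⟨x, hx, y, hxy, hy⟩ := isWalk_append.1 hu
  -- The cut is made before or after `e`, according to the end of `e` that `j` is.
  rcases hj.eq_or_eq_of_isLink hxy with rfl | rfl
  · exact key a (e :: b) rfl hx ⟨y, hxy, hy⟩
  · exact key (a ++ [e]) b (by simp) (isWalk_append.2 ⟨x, hx, isWalk_singleton.2 hxy⟩) hy

/-- Two cycles through a common vertex can be joined at that vertex. -/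
theorem IsBTCycle.exists_merge {γ₁ γ₂ : List E} (h₁ : IsBTCycle G γ₁) (h₂ : IsBTCycle G γ₂)
    {e₁ e₂ : E} (he₁ : e₁ ∈ γ₁) (he₂ : e₂ ∈ γ₂) {j : V} (hj₁ : G.Inc e₁ j) (hj₂ : G.Inc e₂ j) :
    ∃ γ, IsBTCycle G γ ∧ γ.Perm (γ₁ ++ γ₂) := by
  obtain ⟨a, hap, haw, hac, hat⟩ := h₁.exists_perm he₁ hj₁
  obtain ⟨b, hbp, hbw, hbc, hbt⟩ := h₂.exists_perm he₂ hj₂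
  have ha0 : a ≠ [] := by
    rintro rfl
    simp at hat
  have hb0 : b ≠ [] := by
    rintro rfl
    simp at hbt
  -- If one of the two joints backtracks, reversing `b` repairs both: the ends of `a` differ, and so
  -- do those of `b`.
  by_cases hab : a.getLast? ≠ b.head? ∧ b.getLast? ≠ a.head?
  · exact ⟨a ++ b, haw.isBTCycle_append hbw hac hbc ha0 hb0 hab.1 hab.2, hap.append hbp⟩
  · refine ⟨a ++ b.reverse, haw.isBTCycle_append hbw.reverse hac ?_ ha0 (by simpa using hb0)
      ?_ ?_, hap.append ((List.reverse_perm b).trans hbp)⟩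
    · rw [List.isChain_reverse]
      exact hbc.imp fun _ _ h => h.symm
    · rw [List.head?_reverse]
      grind
    · rw [List.getLast?_reverse]
      grind

/-- Induction on the number of cycles, merging `γ` with one that meets it. If none does,
connectedness confines the support to the edges of `γ`, so another cycle would share an edge with
`γ`; hence `γ` is the only one. -/
theorem exists_isBTCycle_of_connected [DecidableEq E] (hE : ∀ e, ∃ x y, G.IsLink e x y) :
    ∀ (n : ℕ) (Γ : Multiset (List E)), Γ.card = n → (∀ γ ∈ Γ, IsBTCycle G γ) →
    IsConnectedEdgeSet G {i | 0 < (Γ.map fun γ => γ.count i).sum} →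
    ∃ γ, IsBTCycle G γ ∧ ∀ i, (Γ.map fun γ => γ.count i).sum = γ.count i := by
  intro n
  induction n with
  | zero =>
    intro Γ hn _ hc
    rw [Multiset.card_eq_zero] at hn
    subst hn
    obtain ⟨e, he⟩ := hc.1
    simp at he
  | succ n ih =>
    intro Γ hn hΓ hc
    obtain ⟨γ, hmemΓ⟩ := Multiset.card_pos_iff_exists_mem.1 (by omega : 0 < Γ.card)
    obtain ⟨Γ', rfl⟩ := Multiset.exists_cons_of_mem hmemΓ
    have hγ : IsBTCycle G γ := hΓ γ (by simp)
    have hmem : ∀ i, 0 < ((γ ::ₘ Γ').map fun γ => γ.count i).sum ↔ ∃ γ' ∈ γ ::ₘ Γ', i ∈ γ' := by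
      intro i
      rw [Nat.pos_iff_ne_zero, Ne, Multiset.sum_eq_zero_iff]
      simp [List.count_eq_zero]
      grind
    by_cases hshare : ∃ γ' ∈ Γ', ∃ e ∈ γ, ∃ e' ∈ γ', ∃ v, G.Inc e v ∧ G.Inc e' v
    · obtain ⟨γ', hγ', e, he, e', he', v, hev, hev'⟩ := hshare
      obtain ⟨Γ'', rfl⟩ := Multiset.exists_cons_of_mem hγ'
      obtain ⟨δ, hδ, hδp⟩ := hγ.exists_merge (hΓ γ' (by simp)) he he' hev hev'
      have hcount : ∀ i, ((δ ::ₘ Γ'').map fun γ => γ.count i).sum =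
          ((γ ::ₘ γ' ::ₘ Γ'').map fun γ => γ.count i).sum := fun i => by
        simp [hδp.count_eq, add_assoc]
      obtain ⟨θ, hθ, hθc⟩ := ih (δ ::ₘ Γ'') (by simpa using hn) (by
        intro θ hθ
        rcases Multiset.mem_cons.1 hθ with rfl | h
        · exact hδ
        · exact hΓ θ (by simp [h])) (by simpa only [hcount] using hc)
      exact ⟨θ, hθ, fun i => by rw [← hcount i, hθc i]⟩
    · push Not at hshare
      have hsub : ∀ f, 0 < ((γ ::ₘ Γ').map fun γ => γ.count f).sum → f ∈ γ := by
        intro f hf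
        obtain ⟨e, he⟩ := List.exists_mem_of_ne_nil γ hγ.1.1
        have hr := hc.2 e ((hmem e).2 ⟨γ, by simp, he⟩) f hf
        clear hf
        induction hr with
        | refl => exact he
        | tail _ hbc ihb =>
          obtain ⟨hcS, v, hbv, hcv⟩ := hbc
          obtain ⟨γ', hγ', hcγ'⟩ := (hmem _).1 hcS
          rcases Multiset.mem_cons.1 hγ' with rfl | h
          · exact hcγ'
          · exact absurd hcv (hshare γ' h _ ihb _ hcγ' v hbv)
      rcases Multiset.empty_or_exists_mem Γ' with rfl | ⟨γ', hγ'⟩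
      · exact ⟨γ, hγ, fun i => by simp⟩
      · obtain ⟨e, he⟩ := List.exists_mem_of_ne_nil γ' (hΓ γ' (by simp [hγ'])).1.1
        obtain ⟨x, y, hxy⟩ := hE e
        exact absurd hxy.inc_left (hshare γ' hγ' e
          (hsub e ((hmem e).2 ⟨γ', by simp [hγ'], he⟩)) e he x hxy.inc_left)

/-- The relation constrains only its target to `S`, hence both directions; two edges are then
connected through the first one. -/
theorem IsWalk.reflTransGen {S : Set E} (l : List E) : ∀ {u v : V} {e : E}, IsWalk G u (e :: l) v →
    (∀ f ∈ e :: l, f ∈ S) → ∀ f ∈ e :: l,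
    Relation.ReflTransGen (fun a b => b ∈ S ∧ ∃ v, G.Inc a v ∧ G.Inc b v) e f ∧
    Relation.ReflTransGen (fun a b => b ∈ S ∧ ∃ v, G.Inc a v ∧ G.Inc b v) f e := by
  induction l with
  | nil =>
    intro u v e _ _ f hf
    obtain rfl : f = e := by simpa using hf
    exact ⟨.refl, .refl⟩
  | cons e' l ih =>
    rintro u v e ⟨x, hx, h⟩ hS f hf
    rcases List.mem_cons.1 hf with rfl | hf
    · exact ⟨.refl, .refl⟩
    · obtain ⟨h1, h2⟩ := ih h (fun g hg => hS g (List.mem_cons_of_mem _ hg)) f hf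
      have hx' := h.inc_head rfl
      exact ⟨.head ⟨hS e' (by simp), x, hx.inc_right, hx'⟩ h1,
        h2.tail ⟨hS e (by simp), x, hx', hx.inc_right⟩⟩

theorem IsBTCycle.isConnectedEdgeSet [DecidableEq E] {γ : List E} (h : IsBTCycle G γ) :
    IsConnectedEdgeSet G {i | 0 < γ.count i} := by
  obtain ⟨⟨u, hu⟩, -, ht⟩ := isBTCycle_iff.1 h
  cases γ with
  | nil => simp at ht
  | cons e₀ l =>
    have hS : ∀ f ∈ e₀ :: l, f ∈ {i | 0 < (e₀ :: l).count i} :=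
      fun f hf => List.count_pos_iff.2 hf
    refine ⟨⟨e₀, hS e₀ (by simp)⟩, fun e he f hf => ?_⟩
    exact (hu.reflTransGen l hS e (List.count_pos_iff.1 he)).2.trans
      (hu.reflTransGen l hS f (List.count_pos_iff.1 hf)).1

end Merge

/-! ### Pseudo-codewords are the balanced vectors -/

section CodeCovers

variable {J I : Type*} {H : Matrix J I (ZMod 2)}

theorem normalGraph_inc_iff (hH : IsCycleCode H) {i : I} {j : J} :
    (normalGraph H).Inc i j ↔ H j i = 1 := by
  constructor
  · rintro ⟨y, -, hy⟩
    have : j ∈ checksOf H i := hy ▸ Set.mem_insert _ _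
    exact this
  · intro h
    obtain ⟨a, b, hab, hi⟩ := Set.ncard_eq_two.1 (hH i)
    have hj : j ∈ checksOf H i := h
    rw [hi] at hj
    rcases hj with rfl | rfl
    · exact ⟨b, hab, hi⟩
    · exact ⟨a, hab.symm, hi.trans (Set.pair_comm _ _)⟩

theorem normalGraph_not_isLink_self (H : Matrix J I (ZMod 2)) (i : I) (j : J) :
    ¬ (normalGraph H).IsLink i j j := fun h => h.1 rfl

theorem normalGraph_exists_isLink (hH : IsCycleCode H) (i : I) :
    ∃ x y, (normalGraph H).IsLink i x y := by
  obtain ⟨a, b, hab, hi⟩ := Set.ncard_eq_two.1 (hH i)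
  exact ⟨a, b, hab, hi⟩

theorem Balanced.sum {E ι : Type*} {s : Finset E} (F : Finset ι) (a : ι → E → ℕ)
    (h : ∀ w ∈ F, Balanced s (a w)) : Balanced s (fun i => ∑ w ∈ F, a w i) := by
  classical
  induction F using Finset.induction_on with
  | empty => simpa using Balanced.zero s
  | insert w F hw ih =>
    simp only [Finset.sum_insert hw]
    exact (h w (by simp)).add (ih fun w' hw' => h w' (by simp [hw']))

/-- An entry 1 makes the even sum positive, hence at least 2. -/
theorem Balanced.of_le_one {E : Type*} {s : Finset E} {a : E → ℕ} (h : Even (∑ i ∈ s, a i))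
    (h1 : ∀ i ∈ s, a i ≤ 1) : Balanced s a := by
  refine ⟨h, fun i hi => ?_⟩
  have := h1 i hi
  have := Finset.single_le_sum (f := a) (fun _ _ => Nat.zero_le _) hi
  obtain ⟨k, hk⟩ := h
  omega

/-- Each copy of a bit at `j` has exactly one neighbour over `j`, so `p` is, on the edges at `j`,
the sum of the local views `a w` of the copies `w` of `j`. Each view is 0-1 valued with even sum. -/
theorem isBalanced_of_isUnscaledPseudoCodeword [Fintype I] (hH : IsCycleCode H) {p : I → ℕ}
    (hp : IsUnscaledPseudoCodeword H p) : IsBalanced (normalGraph H) p := by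
  classical
  obtain ⟨M, W, _, Y, π, c, -, ⟨⟨-, hπ⟩, -⟩, hc, hp⟩ := hp
  have hp' : ∀ i, p i = ∑ x : BitNode π with π x.1 = Sum.inl i, (c x).val := fun i => by
    rw [hp i, unscaledPseudoCodeword]
    congr!
  have hc' : ∀ w j, π w = Sum.inr j → ∑ x : BitNode π with Y.Adj w x.1, c x = 0 :=
    fun w j hw => by
      rw [← hc w j hw]
      congr!
  intro j
  let F : Finset W := Finset.univ.filter fun w => π w = Sum.inr j
  let a : W → I → ℕ := fun w i =>
    ∑ x ∈ Finset.univ.filter (fun x : BitNode π => π x.1 = Sum.inl i),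
      if Y.Adj w x.1 then (c x).val else 0
  have hpa : ∀ i ∈ edgesAt (normalGraph H) j, p i = ∑ w ∈ F, a w i := by
    intro i hi
    rw [mem_edgesAt, normalGraph_inc_iff hH] at hi
    rw [hp' i, Finset.sum_comm]
    refine Finset.sum_congr rfl fun x hx => ?_
    have hx : π x.1 = Sum.inl i := by simpa using hx
    have hb := hπ x.1
    rw [hx] at hb
    obtain ⟨w, hw, hwj⟩ := hb.surjOn (show Sum.inr j ∈ (tannerGraph H).neighborSet (Sum.inl i)
      from hi)
    rw [Finset.sum_eq_single_of_mem w (by simpa [F] using hwj), if_pos (Y.adj_symm hw)]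
    intro w' hw' hne
    have hw' : π w' = Sum.inr j := by simpa [F] using hw'
    rw [if_neg]
    exact fun hadj => hne (hb.injOn (Y.adj_symm hadj) hw (hw'.trans hwj.symm))
  refine (Balanced.sum F a fun w hw => ?_).congr hpa
  have hw : π w = Sum.inr j := by simpa [F] using hw
  have hb := hπ w
  rw [hw] at hb
  apply Balanced.of_le_one
  · have hsum : ∑ i ∈ edgesAt (normalGraph H) j, a w i =
        ∑ x ∈ Finset.univ.filter (fun x : BitNode π => Y.Adj w x.1), (c x).val := by
      simp only [a, Finset.sum_filter]
      rw [Finset.sum_comm]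
      refine Finset.sum_congr rfl fun x _ => ?_
      obtain ⟨i, hi⟩ := x.2
      by_cases hadj : Y.Adj w x.1
      · have hmem : i ∈ edgesAt (normalGraph H) j := by
          rw [mem_edgesAt, normalGraph_inc_iff hH]
          have := hb.mapsTo hadj
          rw [hi] at this
          exact this
        rw [Finset.sum_eq_single_of_mem i hmem]
        · simp [hi, hadj]
        · intro i' _ hne
          rw [hi, if_neg]
          simpa using hne.symm
      · simp [hadj]
    rw [hsum, ← ZMod.natCast_eq_zero_iff_even, Nat.cast_sum]
    simpa using hc' w j hw
  · intro i hi
    simp only [a]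
    by_cases hex : ∃ x : BitNode π, π x.1 = Sum.inl i ∧ Y.Adj w x.1
    · obtain ⟨x, hx, hadj⟩ := hex
      rw [Finset.sum_eq_single_of_mem x (by simpa using hx), if_pos hadj]
      · have := ZMod.val_lt (c x)
        omega
      · intro x' hx' hne
        have hx' : π x'.1 = Sum.inl i := by simpa using hx'
        rw [if_neg]
        exact fun h => hne (Subtype.ext (hb.injOn h hadj (hx'.trans hx.symm)))
    · push Not at hex
      rw [Finset.sum_eq_zero]
      · exact Nat.zero_le _
      · intro x hx
        rw [if_neg (hex x (by simpa using hx))]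

section Voltage

variable {V : Type*} {X : SimpleGraph V} {k M : ℕ}

/-- The derived graph of permutation voltages `τ`. -/
def voltageGraph (X : SimpleGraph V) (e : Fin k ≃ V) (τ : V → V → Equiv.Perm (Fin M))
    (hτ : ∀ x y, τ y x = (τ x y)⁻¹) : SimpleGraph (Fin k × Fin M) where
  Adj w w' := X.Adj (e w.1) (e w'.1) ∧ w'.2 = τ (e w.1) (e w'.1) w.2
  symm := ⟨fun w w' h => ⟨h.1.symm, by rw [hτ, h.2]; simp⟩⟩
  loopless := ⟨fun _ h => X.loopless.irrefl _ h.1⟩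

/-- The projection from the derived graph to the base graph. -/
def voltageHom (X : SimpleGraph V) (e : Fin k ≃ V) (τ : V → V → Equiv.Perm (Fin M))
    (hτ : ∀ x y, τ y x = (τ x y)⁻¹) : voltageGraph X e τ hτ →g X where
  toFun w := e w.1
  map_rel' h := h.1

theorem voltageHom_isMCover (e : Fin k ≃ V) (τ : V → V → Equiv.Perm (Fin M))
    (hτ : ∀ x y, τ y x = (τ x y)⁻¹) (hM : 0 < M) : IsMCover M (voltageHom X e τ hτ) := by
  refine ⟨⟨fun x => ⟨(e.symm x, ⟨0, hM⟩), e.apply_symm_apply x⟩, fun y => ⟨?_, ?_, ?_⟩⟩,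
    fun x => ⟨Set.toFinite _, ?_⟩⟩
  · exact fun w hw => hw.1
  · rintro ⟨w, s⟩ hw ⟨w', s'⟩ hw' h
    obtain rfl : w = w' := e.injective h
    exact Prod.ext rfl (hw.2.trans hw'.2.symm)
  · intro x hx
    refine ⟨(e.symm x, τ (e y.1) x y.2), ⟨?_, ?_⟩, e.apply_symm_apply x⟩
    · rw [Equiv.apply_symm_apply]
      exact hx
    · simp
  · have : voltageHom X e τ hτ ⁻¹' {x} = Set.range fun s : Fin M => (e.symm x, s) := by
      ext ⟨w, s⟩
      simp [voltageHom, Equiv.symm_apply_eq, eq_comm (a := x)]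
    rw [this, ← Set.image_univ, Set.ncard_image_of_injective _ (Prod.mk_right_injective _)]
    simp

end Voltage

theorem exists_perm_iff {α : Type*} [Fintype α] [DecidableEq α] (A B : Finset α)
    (h : A.card = B.card) : ∃ σ : Equiv.Perm α, ∀ s, s ∈ A ↔ σ s ∈ B := by
  refine ⟨(Finset.equivOfCardEq h).extendSubtype, fun s => ⟨fun hs => ?_, fun hs => ?_⟩⟩
  · exact Equiv.extendSubtype_mem _ _ hs
  · by_contra hs'
    exact Equiv.extendSubtype_not_mem (Finset.equivOfCardEq h) s hs' hs

/-- The first `p i` copies of bit `i` carry 1, and copy `t` of check `j` is to see ones exactly at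
the bits in `T j t`. Since `i` lies in `p i` of these sets, a permutation `σ i j` of the copies
achieves this; it becomes the voltage. -/
theorem isUnscaledPseudoCodeword_of_isBalanced [Fintype I] [Fintype J] (hH : IsCycleCode H)
    {p : I → ℕ} (hp : IsBalanced (normalGraph H) p) : IsUnscaledPseudoCodeword H p := by
  classical
  choose N hN using fun j => Balanced.exists_even_family _ _ p rfl (hp j)
  obtain ⟨M, hM0, hMN, hMp⟩ : ∃ M, 0 < M ∧ (∀ j, N j ≤ M) ∧ ∀ i, p i ≤ M := by
    refine ⟨∑ j, N j + ∑ i, p i + 1, by omega, fun j => ?_, fun i => ?_⟩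
    · have := Finset.single_le_sum (f := N) (fun _ _ => Nat.zero_le _) (Finset.mem_univ j)
      omega
    · have := Finset.single_le_sum (f := p) (fun _ _ => Nat.zero_le _) (Finset.mem_univ i)
      omega
  choose T hT hTp using fun j => hN j M (hMN j)
  have hcard : ∀ i, (Finset.univ.filter fun s : Fin M => s.1 < p i).card = p i := fun i => by
    rw [Fin.card_filter_val_lt, min_eq_right (hMp i)]
  have hσ : ∀ i j, ∃ σ : Equiv.Perm (Fin M), H j i = 1 → ∀ s, s.1 < p i ↔ i ∈ T j (σ s) := by
    intro i j
    by_cases h : H j i = 1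
    · have hi : i ∈ edgesAt (normalGraph H) j := mem_edgesAt.2 ((normalGraph_inc_iff hH).2 h)
      obtain ⟨σ, hσ⟩ := exists_perm_iff (Finset.univ.filter fun s : Fin M => s.1 < p i)
        (Finset.univ.filter fun t => i ∈ T j t) (by
          rw [hcard i, Finset.card_filter, hTp j i hi])
      exact ⟨σ, fun _ s => by simpa using hσ s⟩
    · exact ⟨1, fun h' => absurd h' h⟩
  choose σ hσ using hσ
  let τ : I ⊕ J → I ⊕ J → Equiv.Perm (Fin M)
    | .inl i, .inr j => σ i j
    | .inr j, .inl i => (σ i j)⁻¹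
    | _, _ => 1
  have hτ : ∀ x y, τ y x = (τ x y)⁻¹ := by
    rintro (i | j) (i' | j') <;> simp [τ]
  -- The nodes are relabelled by `Fin` because the cover has to live in `Type`, whatever the
  -- universes of `I` and `J`.
  let e := (Fintype.equivFin (I ⊕ J)).symm
  let π := voltageHom (tannerGraph H) e τ hτ
  have hπ : ∀ w, π w = e w.1 := fun _ => rfl
  let c : BitNode π → ZMod 2 := fun x =>
    Sum.elim (fun i => if x.1.2.1 < p i then 1 else 0) (fun _ => 0) (π x.1)
  refine ⟨M, _, inferInstance, _, π, c, hM0, voltageHom_isMCover e τ hτ hM0, ?_, ?_⟩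
  · intro w j hw
    have hsum : ∑ i ∈ edgesAt (normalGraph H) j, (if i ∈ T j w.2 then (1 : ZMod 2) else 0) = 0 := by
      rw [Finset.sum_ite_mem, Finset.inter_eq_right.2 (hT j w.2).1]
      simpa using (ZMod.natCast_eq_zero_iff_even).2 (hT j w.2).2
    rw [← hsum]
    symm
    refine Finset.sum_bij
      (fun i _ => (⟨(e.symm (.inl i), (σ i j)⁻¹ w.2), i, e.apply_symm_apply _⟩ : BitNode π))
      ?_ ?_ ?_ ?_
    · intro i hi
      have hw' : e w.1 = .inr j := hw
      rw [mem_edgesAt, normalGraph_inc_iff hH] at hi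
      simp only [Finset.mem_filter, Finset.mem_univ, true_and]
      refine ⟨?_, ?_⟩
      · simp only [hw', Equiv.apply_symm_apply]
        exact hi
      · simp only [hw', Equiv.apply_symm_apply]
        rfl
    · intro i _ i' _ h
      simpa using congrArg (fun x : BitNode π => x.1.1) h
    · rintro ⟨⟨a, s⟩, i, hi⟩ hx
      have hw' : e w.1 = .inr j := hw
      have hi' : e a = .inl i := hi
      simp only [Finset.mem_filter, Finset.mem_univ, true_and] at hx
      obtain ⟨h1, h2⟩ := hx
      simp only [hw', hi'] at h1 h2
      refine ⟨i, mem_edgesAt.2 ((normalGraph_inc_iff hH).2 h1), Subtype.ext (Prod.ext ?_ h2.symm)⟩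
      simp [← hi']
    · intro i hi
      rw [mem_edgesAt, normalGraph_inc_iff hH] at hi
      have := hσ i j hi ((σ i j)⁻¹ w.2)
      rw [← Equiv.Perm.mul_apply, mul_inv_cancel, Equiv.Perm.one_apply] at this
      simp only [c, hπ, Equiv.apply_symm_apply, Sum.elim_inl, this]
  · intro i
    rw [← hcard i, Finset.card_filter]
    unfold unscaledPseudoCodeword
    refine Finset.sum_bij'
      (fun s _ => (⟨(e.symm (.inl i), s), i, e.apply_symm_apply _⟩ : BitNode π))
      (fun x _ => x.1.2) ?_ ?_ ?_ ?_ ?_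
    · intro s _
      simp [hπ]
    · simp
    · simp
    · rintro ⟨⟨a, s⟩, hx'⟩ hx
      have hx : e a = .inl i := by simpa [hπ] using hx
      simp [← hx]
    · intro s _
      simp only [c, hπ, Equiv.apply_symm_apply, Sum.elim_inl]
      split_ifs <;> simp [ZMod.val_one]

end CodeCovers

/-! ### Supports of products of geometric series -/

section GeometricProducts

variable {E : Type*}

open MvPowerSeries

theorem one_sub_monomial_mul_invOfUnit {m : E →₀ ℕ} (hm : m ≠ 0) :
    (1 - monomial m (1 : ℤ)) * invOfUnit (1 - monomial m (1 : ℤ)) 1 = 1 := by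
  classical
  apply mul_invOfUnit
  rw [map_sub, ← coeff_zero_eq_constantCoeff_apply, ← coeff_zero_eq_constantCoeff_apply,
    coeff_monomial, if_neg hm.symm]
  simp

theorem invOfUnit_eq_one_add {m : E →₀ ℕ} (hm : m ≠ 0) :
    invOfUnit (1 - monomial m (1 : ℤ)) 1 =
      1 + monomial m (1 : ℤ) * invOfUnit (1 - monomial m (1 : ℤ)) 1 := by
  have := one_sub_monomial_mul_invOfUnit hm
  rw [sub_mul, one_mul, sub_eq_iff_eq_add] at this
  exact this

/-- The series has nonnegative coefficients, and those not zero are at the elements of `S`. -/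
def IsNonnegWithSupport (f : MvPowerSeries E ℤ) (S : AddSubmonoid (E →₀ ℕ)) : Prop :=
  ∀ n, 0 ≤ coeff n f ∧ (coeff n f ≠ 0 ↔ n ∈ S)

theorem IsNonnegWithSupport.one : IsNonnegWithSupport (1 : MvPowerSeries E ℤ) ⊥ := by
  classical
  intro n
  rw [coeff_one, AddSubmonoid.mem_bot]
  split_ifs with h <;> simp [h]

/-- Nonnegative summands cannot cancel. -/
theorem IsNonnegWithSupport.mul {f g : MvPowerSeries E ℤ} {S T : AddSubmonoid (E →₀ ℕ)}
    (hf : IsNonnegWithSupport f S) (hg : IsNonnegWithSupport g T) :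
    IsNonnegWithSupport (f * g) (S ⊔ T) := by
  classical
  intro n
  have hnn : ∀ x ∈ Finset.HasAntidiagonal.antidiagonal n, 0 ≤ coeff x.1 f * coeff x.2 g := fun x _ =>
    mul_nonneg (hf x.1).1 (hg x.2).1
  rw [coeff_mul]
  refine ⟨Finset.sum_nonneg hnn, ?_⟩
  rw [Ne, Finset.sum_eq_zero_iff_of_nonneg hnn, AddSubmonoid.mem_sup]
  push Not
  constructor
  · rintro ⟨⟨a, b⟩, hx, hne⟩
    exact ⟨a, (hf a).2.1 (left_ne_zero_of_mul hne), b, (hg b).2.1 (right_ne_zero_of_mul hne),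
      Finset.HasAntidiagonal.mem_antidiagonal.1 hx⟩
  · rintro ⟨a, ha, b, hb, hab⟩
    exact ⟨(a, b), Finset.HasAntidiagonal.mem_antidiagonal.2 hab, mul_ne_zero ((hf a).2.2 ha) ((hg b).2.2 hb)⟩

/-- With `f` the series and `X^m` its monomial, `f = 1 + X^m * f` determines the coefficients by
induction on the degree. -/
theorem isNonnegWithSupport_geometric {m : E →₀ ℕ} (hm : m ≠ 0) :
    IsNonnegWithSupport (invOfUnit (1 - monomial m (1 : ℤ)) 1) (AddSubmonoid.multiples m) := by
  classical
  set f := invOfUnit (1 - monomial m (1 : ℤ)) 1 with hf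
  have hrec : ∀ n, coeff n f = (if n = 0 then 1 else 0) + if m ≤ n then coeff (n - m) f else 0 := by
    intro n
    conv_lhs => rw [hf, invOfUnit_eq_one_add hm]
    rw [map_add, coeff_one, coeff_monomial_mul, one_mul]
  have hmdeg : 0 < m.degree := Nat.pos_of_ne_zero ((Finsupp.degree_eq_zero_iff m).not.2 hm)
  have hm0 : ¬ m ≤ 0 := fun h => hm (by simpa using h)
  suffices h : ∀ (N : ℕ) (n : E →₀ ℕ), n.degree = N →
      0 ≤ coeff n f ∧ (coeff n f ≠ 0 ↔ n ∈ AddSubmonoid.multiples m) from fun n => h _ n rfl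
  intro N
  induction N using Nat.strong_induction_on with
  | _ N ih =>
    intro n hn
    rw [hrec n]
    by_cases hn0 : n = 0
    · subst hn0
      simp [hm0, zero_mem]
    · by_cases hmn : m ≤ n
      · obtain ⟨n', rfl⟩ := exists_add_of_le hmn
        rw [map_add] at hn
        obtain ⟨h1, h2⟩ := ih n'.degree (by omega) n' rfl
        simp only [hn0, if_false, hmn, if_true, add_tsub_cancel_left, zero_add]
        refine ⟨h1, h2.trans ⟨fun h => add_mem (AddSubmonoid.mem_multiples m) h, ?_⟩⟩
        rintro ⟨k, hk⟩
        cases k with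
        | zero => exact absurd (by simpa using hk.symm) hn0
        | succ k =>
          refine ⟨k, ?_⟩
          simp only [succ_nsmul'] at hk
          exact add_left_cancel hk
      · simp only [hn0, hmn, if_false, add_zero, le_refl, ne_eq, not_true_eq_false, true_and,
          false_iff]
        rintro ⟨k, rfl⟩
        cases k with
        | zero => exact hn0 (zero_nsmul m)
        | succ k => exact hmn (by simp [succ_nsmul'])

variable {ι : Type*} {m : ι → E →₀ ℕ}

theorem isNonnegWithSupport_prod (hm : ∀ c, m c ≠ 0) (F : Finset ι) :
    IsNonnegWithSupport (∏ c ∈ F, invOfUnit (1 - monomial (m c) (1 : ℤ)) 1)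
      (AddSubmonoid.closure (m '' F)) := by
  classical
  induction F using Finset.induction_on with
  | empty => simpa using IsNonnegWithSupport.one
  | insert c F hc ih =>
    rw [Finset.prod_insert hc, Finset.coe_insert, Set.image_insert_eq, Set.insert_eq,
      AddSubmonoid.closure_union, ← AddSubmonoid.multiples_eq_closure]
    exact (isNonnegWithSupport_geometric (hm c)).mul ih

/-- Expanding the product of the `1 + (factor - 1)` over finite sets `F`, the term of `F`
contributes at `n` only if `m c ≤ n` for all `c ∈ F`, which leaves finitely many `F`. -/
theorem multipliable_geometric (hm : ∀ c, m c ≠ 0) (hfin : ∀ n, {c | m c ≤ n}.Finite) :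
    Multipliable fun c => invOfUnit (1 - monomial (m c) (1 : ℤ)) 1 := by
  classical
  have hfun : (fun c => invOfUnit (1 - monomial (m c) (1 : ℤ)) 1) = fun c =>
      1 + monomial (m c) (1 : ℤ) * invOfUnit (1 - monomial (m c) (1 : ℤ)) 1 :=
    funext fun c => invOfUnit_eq_one_add (hm c)
  rw [hfun]
  refine multipliable_one_add_of_summable_prod
    (WithPiTopology.summable_iff_summable_coeff.2 fun n => summable_of_hasFiniteSupport ?_)
  refine ((hfin n).toFinset.powerset.finite_toSet).subset fun F hF => ?_
  simp only [Finset.coe_powerset, Set.mem_preimage, Set.mem_powerset_iff, Finset.coe_subset]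
  intro c hc
  rw [Set.Finite.mem_toFinset]
  by_contra hcn
  apply hF
  change coeff n (∏ c ∈ F, _) = 0
  rw [← Finset.mul_prod_erase F _ hc, mul_assoc, coeff_monomial_mul, if_neg (show ¬ m c ≤ n from hcn)]

theorem coeff_tprod_geometric_ne_zero_iff (hm : ∀ c, m c ≠ 0) (hfin : ∀ n, {c | m c ≤ n}.Finite)
    (n : E →₀ ℕ) :
    coeff n (∏' c, invOfUnit (1 - monomial (m c) (1 : ℤ)) 1) ≠ 0 ↔
      n ∈ AddSubmonoid.closure (Set.range m) := by
  classical
  have hp := (multipliable_geometric hm hfin).hasProd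
  rw [HasProd, SummationFilter.unconditional_filter,
    WithPiTopology.tendsto_iff_coeff_tendsto] at hp
  have hev := hp n
  -- As `ℤ` is discrete, the `n`-th coefficient is constant on all finite sets beyond some `F₀`.
  rw [nhds_discrete, Filter.tendsto_pure, Filter.eventually_atTop] at hev
  obtain ⟨F₀, hF₀⟩ := hev
  constructor
  · intro h
    rw [← hF₀ F₀ le_rfl] at h
    exact AddSubmonoid.closure_mono (Set.image_subset_range _ _)
      ((isNonnegWithSupport_prod hm F₀ n).2.1 h)
  · intro h
    obtain ⟨F, hF⟩ : ∃ F : Finset ι, n ∈ AddSubmonoid.closure (m '' F) := by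
      clear hF₀
      induction h using AddSubmonoid.closure_induction with
      | mem x hx =>
        obtain ⟨c, rfl⟩ := hx
        exact ⟨{c}, AddSubmonoid.subset_closure (by simp)⟩
      | zero => exact ⟨∅, zero_mem _⟩
      | add x y _ _ hx hy =>
        obtain ⟨F, hF⟩ := hx
        obtain ⟨F', hF'⟩ := hy
        refine ⟨F ∪ F', add_mem (AddSubmonoid.closure_mono (Set.image_mono ?_) hF)
          (AddSubmonoid.closure_mono (Set.image_mono ?_) hF')⟩ <;> simp
    rw [← hF₀ (F₀ ∪ F) Finset.subset_union_left]
    refine (isNonnegWithSupport_prod hm _ n).2.2 (AddSubmonoid.closure_mono (Set.image_mono ?_) hF)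
    simp

end GeometricProducts

/-! ### The support of the edge zeta function -/

section EdgeZeta

variable {V E : Type*} {G : Graph V E}

/-- With two copies of `θ` in succession, taillessness of `θ` is the absence of backtracking at
their joint. -/
theorem IsBTCycle.of_flatten_replicate {θ : List E} {r : ℕ} (hr : 2 ≤ r) (hθ : IsCycle G θ)
    (h : IsBTCycle G (List.replicate r θ).flatten) : IsBTCycle G θ := by
  obtain ⟨r, rfl⟩ : ∃ r', r = r' + 2 := ⟨r - 2, by omega⟩
  have hc := h.2.1
  unfold IsBacktrackless at hc
  rw [List.replicate_succ, List.replicate_succ, List.flatten_cons, List.flatten_cons,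
    List.isChain_append] at hc
  refine ⟨hθ, hc.1, fun hcon => ?_⟩
  have hθ0 := hθ.1
  refine hc.2.2 (θ.head hθ0) ?_ (θ.head hθ0) ?_ rfl
  · rw [Option.mem_def, ← hcon, List.head?_eq_some_head hθ0]
  · rw [Option.mem_def, List.head?_append_of_ne_nil _ hθ0, List.head?_eq_some_head hθ0]

variable [DecidableEq E]

/-- The exponent vector of the monomial of a cycle. -/
noncomputable def cycleExponent (c : Cycle E) : E →₀ ℕ := Multiset.toFinsupp c.toMultiset

theorem cycleMonomial_eq (c : Cycle E) :
    cycleMonomial c = MvPowerSeries.monomial (cycleExponent c) 1 := by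
  unfold cycleMonomial cycleExponent
  induction c.toMultiset using Multiset.induction_on with
  | empty => simp
  | cons e s ih =>
    rw [Multiset.map_cons, Multiset.prod_cons, ih, MvPowerSeries.X,
      MvPowerSeries.monomial_mul_monomial, ← Multiset.singleton_add, map_add,
      Multiset.toFinsupp_singleton, one_mul]

theorem cycleExponent_coe_apply (γ : List E) (e : E) : cycleExponent (γ : Cycle E) e = γ.count e := by
  simp [cycleExponent]

theorem cycleExponent_ne_zero (c : primeClasses G) : cycleExponent c.1 ≠ 0 := by
  obtain ⟨γ, hγ, h, -⟩ := c.2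
  rw [← hγ]
  intro h0
  simp only [cycleExponent, Cycle.coe_toMultiset] at h0
  rw [map_eq_zero_iff _ Multiset.toFinsupp.injective] at h0
  exact h.1.1 (by simpa using h0)

/-- The degree of the exponent is the length of the cycle, and there are finitely many lists of
bounded length. -/
theorem finite_cycleExponent_le [Finite E] (n : E →₀ ℕ) :
    {c : primeClasses G | cycleExponent c.1 ≤ n}.Finite := by
  refine Set.Finite.of_finite_image (f := Subtype.val) (((List.finite_length_le E n.degree).image
    ((↑) : List E → Cycle E)).subset ?_) Subtype.val_injective.injOn
  rintro _ ⟨⟨c, hc⟩, hle, rfl⟩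
  induction c using Quotient.inductionOn with
  | _ l =>
    refine ⟨l, ?_, rfl⟩
    have h := Finsupp.degree_mono hle
    have h2 : (cycleExponent (l : Cycle E)).degree = l.length := by
      rw [cycleExponent, Cycle.coe_toMultiset, Finsupp.degree_apply]
      exact (Multiset.toFinsupp_sum_eq _).trans (Multiset.coe_card l)
    change (cycleExponent (l : Cycle E)).degree ≤ _ at h
    rw [h2] at h
    exact h

theorem zetaFactor_eq : zetaFactor G = fun c : primeClasses G =>
    MvPowerSeries.invOfUnit (1 - MvPowerSeries.monomial (cycleExponent c.1) (1 : ℤ)) 1 :=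
  funext fun c => by rw [zetaFactor, cycleMonomial_eq]

theorem multipliable_zetaFactor [Finite E] : Multipliable (zetaFactor G) := by
  rw [zetaFactor_eq]
  exact multipliable_geometric cycleExponent_ne_zero finite_cycleExponent_le

theorem coeff_edgeZeta_ne_zero_iff [Finite E] (n : E →₀ ℕ) :
    MvPowerSeries.coeff n (edgeZeta G) ≠ 0 ↔
      n ∈ AddSubmonoid.closure (Set.range fun c : primeClasses G => cycleExponent c.1) := by
  rw [edgeZeta, zetaFactor_eq]
  exact coeff_tprod_geometric_ne_zero_iff cycleExponent_ne_zero finite_cycleExponent_le n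

/-- A cycle that is not primitive repeats a shorter backtrackless tailless one, and its exponent is
a multiple of the shorter one's. -/
theorem IsBTCycle.cycleExponent_mem_closure :
    ∀ (N : ℕ) (γ : List E), γ.length = N → IsBTCycle G γ → cycleExponent (γ : Cycle E) ∈
      AddSubmonoid.closure (Set.range fun c : primeClasses G => cycleExponent c.1) := by
  intro N
  induction N using Nat.strong_induction_on with
  | _ N ih =>
    intro γ hN hγ
    by_cases hprim : IsPrimitive G γ
    · exact AddSubmonoid.subset_closure ⟨⟨γ, γ, rfl, hγ, hprim⟩, rfl⟩
    · obtain ⟨θ, r, hθ, hr, rfl⟩ := not_not.1 hprim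
      have hlen : 0 < θ.length := List.length_pos_iff.2 hθ.1
      have hexp : cycleExponent (((List.replicate r θ).flatten : List E) : Cycle E) =
          r • cycleExponent (θ : Cycle E) := by
        ext e
        rw [cycleExponent_coe_apply, Finsupp.smul_apply, cycleExponent_coe_apply]
        simp [List.count_flatten]
      rw [hexp]
      refine nsmul_mem (ih θ.length ?_ θ rfl (hγ.of_flatten_replicate hr hθ)) r
      rw [List.length_flatten, List.map_replicate, List.sum_replicate, smul_eq_mul] at hN
      nlinarith

theorem coeff_edgeZeta_ne_zero_iff_isBalanced [Fintype E] (hG : ∀ e x, ¬ G.IsLink e x x)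
    (hE : ∀ e, ∃ x y, G.IsLink e x y) (n : E →₀ ℕ) :
    MvPowerSeries.coeff n (edgeZeta G) ≠ 0 ↔ IsBalanced G n := by
  rw [coeff_edgeZeta_ne_zero_iff]
  constructor
  · intro h
    induction h using AddSubmonoid.closure_induction with
    | mem x hx =>
      obtain ⟨⟨_, γ, rfl, hγ, -⟩, rfl⟩ := hx
      have : ⇑(cycleExponent (γ : Cycle E)) = fun e => γ.count e :=
        funext fun e => cycleExponent_coe_apply γ e
      simpa only [this] using hγ.isBalanced hG
    | zero => exact IsBalanced.zero
    | add x y _ _ hx hy => exact fun j => (hx j).add (hy j)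
  · intro h
    obtain ⟨Γ, hΓ, hn⟩ := IsBalanced.exists_multiset hG hE _ _ rfl h
    have hsum : n = (Γ.map fun γ : List E => cycleExponent (γ : Cycle E)).sum := by
      ext e
      rw [hn e, ← Finsupp.applyAddHom_apply e (Multiset.sum _), map_multiset_sum, Multiset.map_map]
      simp [cycleExponent_coe_apply]
    rw [hsum]
    refine AddSubmonoid.multiset_sum_mem _ _ fun x hx => ?_
    obtain ⟨γ, hγ, rfl⟩ := Multiset.mem_map.1 hx
    exact IsBTCycle.cycleExponent_mem_closure _ γ rfl (hΓ γ hγ)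

end EdgeZeta

/-! ### The fundamental cone as a convex hull -/

section Cone

/-- A cone cut out by finitely many rational inequalities is the convex hull of its rational
points. -/
theorem mem_convexHull_rat_of_forall_nonneg {I κ : Type*} [Fintype I] [Finite κ] (A : κ → I → ℚ)
    {ω : I → ℝ} (hω : ∀ k, 0 ≤ ∑ i, (A k i : ℝ) * ω i) :
    ω ∈ convexHull ℝ {x : I → ℝ | (∀ k, 0 ≤ ∑ i, (A k i : ℝ) * x i) ∧
      ∃ q : I → ℚ, ∀ i, x i = q i} := by
  classical
  -- In a `ℚ`-basis `b` of the span of the entries, `ω = L b` with `L` a rational matrix. It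
  -- suffices to surround `b` by a small box with rational vertices that `L` maps into the cone.
  let S : Submodule ℚ ℝ := Submodule.span ℚ (Set.range ω)
  have : Module.Finite ℚ S := Module.Finite.span_of_finite ℚ (Set.finite_range ω)
  let B := Module.finBasis ℚ S
  have hωS : ∀ i, ω i ∈ S := fun i => Submodule.subset_span ⟨i, rfl⟩
  let x : I → Fin (Module.finrank ℚ S) → ℚ := fun i k => B.repr ⟨ω i, hωS i⟩ k
  let b : Fin (Module.finrank ℚ S) → ℝ := fun k => (B k : ℝ)
  have hb : LinearIndependent ℚ b := B.linearIndependent.map' S.subtype (Submodule.ker_subtype S)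
  let L : (Fin (Module.finrank ℚ S) → ℝ) →ₗ[ℝ] (I → ℝ) :=
    LinearMap.pi fun i => ∑ k, (x i k : ℝ) • LinearMap.proj k
  have hL : ∀ t i, L t i = ∑ k, (x i k : ℝ) * t k := fun t i => by
    simp [L]
  have hLb : L b = ω := by
    funext i
    have h : S.subtype (∑ k, B.repr ⟨ω i, hωS i⟩ k • B k) = ω i :=
      congrArg S.subtype (B.sum_repr ⟨ω i, hωS i⟩)
    rw [map_sum] at h
    rw [hL, ← h]
    exact Finset.sum_congr rfl fun k _ => by rw [map_smul, Rat.smul_def]; rfl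
  have hAL : ∀ k t, ∑ i, (A k i : ℝ) * L t i = ∑ l, ((∑ i, A k i * x i l : ℚ) : ℝ) * t l := by
    intro k t
    simp only [hL, Finset.mul_sum, Rat.cast_sum, Rat.cast_mul, Finset.sum_mul, ← mul_assoc]
    rw [Finset.sum_comm]
  have hnear : ∀ᶠ t in nhds b, ∀ k, 0 ≤ ∑ i, (A k i : ℝ) * L t i := by
    rw [Filter.eventually_all]
    intro k
    -- An inequality tight at `ω` is a rational relation among the independent `b`, so it is an
    -- identity in `t`; a strict one persists near `b`.
    rcases (hω k).eq_or_lt with h0 | hpos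
    · rw [← hLb, hAL] at h0
      have hz := Fintype.linearIndependent_iff.1 hb (fun l => ∑ i, A k i * x i l)
        (by simpa [Rat.smul_def] using h0.symm)
      refine Filter.Eventually.of_forall fun t => ?_
      rw [hAL]
      simp only [hz]
      simp
    · have hcont : Continuous fun t => ∑ i, (A k i : ℝ) * L t i := by
        simp only [hL]
        fun_prop
      have := hcont.continuousAt.eventually (lt_mem_nhds (a := 0) (b := ∑ i, (A k i : ℝ) * L b i)
        (by rwa [hLb]))
      exact this.mono fun _ h => h.le
  obtain ⟨ε, hε, hball⟩ := Metric.eventually_nhds_iff.1 hnear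
  choose l hl hl' using fun k => exists_rat_btwn (show b k - ε / 2 < b k by linarith)
  choose r hr hr' using fun k => exists_rat_btwn (show b k < b k + ε / 2 by linarith)
  have hbmem : b ∈ convexHull ℝ (Set.univ.pi fun k => ({(l k : ℝ), (r k : ℝ)} : Set ℝ)) := by
    refine mem_convexHull_pi fun k _ => ?_
    rw [convexHull_pair, segment_eq_Icc ((hl' k).trans (hr k)).le]
    exact ⟨(hl' k).le, (hr k).le⟩
  have hmem : L b ∈ L '' convexHull ℝ (Set.univ.pi fun k => ({(l k : ℝ), (r k : ℝ)} : Set ℝ)) :=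
    ⟨b, hbmem, rfl⟩
  rw [L.image_convexHull, hLb] at hmem
  refine convexHull_mono ?_ hmem
  rintro _ ⟨t, ht, rfl⟩
  refine ⟨hball ?_, ?_⟩
  · refine lt_of_le_of_lt ((dist_pi_le_iff (half_pos hε).le).2 fun k => ?_) (half_lt_self hε)
    have h1 := hl k
    have h2 := hl' k
    have h3 := hr k
    have h4 := hr' k
    rw [Real.dist_eq, abs_le]
    rcases ht k (Set.mem_univ k) with h | h <;> rw [h] <;> constructor <;> linarith
  · have hrat : ∀ k, ∃ q : ℚ, t k = q := fun k => by
      rcases ht k (Set.mem_univ k) with h | h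
      exacts [⟨_, h⟩, ⟨_, h⟩]
    choose q hq using hrat
    exact ⟨fun i => ∑ k, x i k * q k, fun i => by simp [hL, hq]⟩

variable {J I : Type*} [Fintype I] {H : Matrix J I (ZMod 2)}

/-- Adding `ω i` to both sides gives the inequalities of `Balanced`; only parity is missing. -/
theorem mem_fundamentalCone_iff (hH : IsCycleCode H) {ω : I → ℝ} :
    ω ∈ fundamentalCone H ↔ (∀ i, 0 ≤ ω i) ∧ ∀ j, ∀ i ∈ edgesAt (normalGraph H) j,
      2 * ω i ≤ ∑ k ∈ edgesAt (normalGraph H) j, ω k := by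
  classical
  unfold fundamentalCone
  refine and_congr_right fun _ => forall₂_congr fun j i => ?_
  rw [mem_edgesAt, normalGraph_inc_iff hH]
  refine forall_congr' fun hi => ?_
  have hmem : i ∈ edgesAt (normalGraph H) j := mem_edgesAt.2 ((normalGraph_inc_iff hH).2 hi)
  have hset : (Finset.univ.filter fun i' => H j i' = 1 ∧ i' ≠ i) =
      (edgesAt (normalGraph H) j).erase i := by
    ext i'
    simp [mem_edgesAt, normalGraph_inc_iff hH, and_comm]
  rw [← Finset.add_sum_erase _ _ hmem, ← hset]
  constructor
  · intro h
    linarith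
  · intro h
    linarith

theorem convex_fundamentalCone (hH : IsCycleCode H) : Convex ℝ (fundamentalCone H) := by
  intro x hx y hy a b ha hb _
  rw [mem_fundamentalCone_iff hH] at hx hy ⊢
  refine ⟨fun i => ?_, fun j i hi => ?_⟩
  · have := mul_nonneg ha (hx.1 i)
    have := mul_nonneg hb (hy.1 i)
    simp only [Pi.add_apply, Pi.smul_apply, smul_eq_mul]
    linarith
  · have h1 := mul_le_mul_of_nonneg_left (hx.2 j i hi) ha
    have h2 := mul_le_mul_of_nonneg_left (hy.2 j i hi) hb
    simp only [Pi.add_apply, Pi.smul_apply, smul_eq_mul, Finset.sum_add_distrib, ← Finset.mul_sum]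
    linarith

theorem IsBalanced.mem_fundamentalCone (hH : IsCycleCode H) {p : I → ℕ}
    (hp : IsBalanced (normalGraph H) p) : (fun i => (p i : ℝ)) ∈ fundamentalCone H := by
  rw [mem_fundamentalCone_iff hH]
  exact ⟨fun i => Nat.cast_nonneg _, fun j i hi => by exact_mod_cast (hp j).2 i hi⟩

/-- A rational point of the cone has a positive multiple with balanced entries. -/
theorem exists_isBalanced_of_rat (hH : IsCycleCode H) {q : I → ℚ}
    (hq : (fun i => (q i : ℝ)) ∈ fundamentalCone H) :
    ∃ (N : ℕ) (p : I → ℕ), 0 < N ∧ IsBalanced (normalGraph H) p ∧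
      ∀ i, (p i : ℝ) = N * q i := by
  classical
  rw [mem_fundamentalCone_iff hH] at hq
  have hq0 : ∀ i, 0 ≤ q i := fun i => by exact_mod_cast hq.1 i
  let D : ℕ := ∏ i, (q i).den
  have hD : 0 < D := Finset.prod_pos fun i _ => (q i).den_pos
  have hr : ∀ i, ∃ r : ℕ, (r : ℚ) = D * q i := by
    intro i
    refine ⟨(∏ k ∈ Finset.univ.erase i, (q k).den) * (q i).num.toNat, ?_⟩
    have hnum : (((q i).num.toNat : ℕ) : ℚ) = (q i).num := by
      exact_mod_cast Int.toNat_of_nonneg (Rat.num_nonneg.2 (hq0 i))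
    have hDi : D = (q i).den * ∏ k ∈ Finset.univ.erase i, (q k).den :=
      (Finset.mul_prod_erase _ _ (Finset.mem_univ i)).symm
    rw [hDi]
    push_cast
    rw [hnum]
    have := Rat.den_mul_eq_num (q i)
    rw [← this]
    ring
  choose r hr using hr
  have hrR : ∀ i, (r i : ℝ) = D * q i := fun i => by exact_mod_cast congrArg (Rat.cast (K := ℝ)) (hr i)
  -- `D` clears denominators; the extra factor 2 supplies the parity.
  refine ⟨2 * D, fun i => 2 * r i, by omega, fun j => ⟨?_, fun i hi => ?_⟩, fun i => ?_⟩
  · rw [← Finset.mul_sum]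
    exact even_two_mul _
  · have h := mul_le_mul_of_nonneg_left (hq.2 j i hi) (Nat.cast_nonneg (α := ℝ) (2 * D))
    rw [Finset.mul_sum] at h
    have hcast : ∀ k, ((2 * r k : ℕ) : ℝ) = ((2 * D : ℕ) : ℝ) * q k := fun k => by
      push_cast
      rw [hrR]
      ring
    simp only [← hcast] at h
    have h' : ((2 * (2 * r i) : ℕ) : ℝ) ≤ ((∑ k ∈ edgesAt (normalGraph H) j, 2 * r k : ℕ) : ℝ) := by
      rw [Nat.cast_sum]
      refine le_trans (le_of_eq ?_) h
      push_cast
      rw [hrR]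
      ring
    exact_mod_cast h'
  · push_cast
    rw [hrR]
    ring

theorem convexHull_isBalanced_eq [Finite J] (hH : IsCycleCode H) :
    convexHull ℝ {x : I → ℝ | ∃ p : I → ℕ, IsBalanced (normalGraph H) p ∧ x = fun i => (p i : ℝ)} =
      fundamentalCone H := by
  classical
  apply Set.Subset.antisymm
  · refine convexHull_min ?_ (convex_fundamentalCone hH)
    rintro _ ⟨p, hp, rfl⟩
    exact hp.mem_fundamentalCone hH
  · intro ω hω
    -- The rows are the sign conditions, then one inequality for each check and incident edge.
    let A : I ⊕ (Σ j : J, edgesAt (normalGraph H) j) → I → ℚ :=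
      Sum.elim (fun i k => if k = i then 1 else 0) fun a k =>
        (if k ∈ edgesAt (normalGraph H) a.1 then 1 else 0) - 2 * (if k = a.2 then 1 else 0)
    have hA : ∀ x : I → ℝ, x ∈ fundamentalCone H ↔ ∀ a, 0 ≤ ∑ i, (A a i : ℝ) * x i := by
      intro x
      rw [mem_fundamentalCone_iff hH, Sum.forall]
      refine and_congr (forall_congr' fun i => ?_) ?_
      · simp [A, apply_ite (Rat.cast : ℚ → ℝ)]
      · rw [Sigma.forall]
        refine forall_congr' fun j => ?_
        rw [Subtype.forall]
        refine forall₂_congr fun i hi => ?_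
        simp [A, sub_mul, Finset.sum_sub_distrib, apply_ite (Rat.cast : ℚ → ℝ)]
    refine convexHull_min ?_ (convex_convexHull ℝ _)
      (mem_convexHull_rat_of_forall_nonneg A ((hA ω).1 hω))
    rintro x ⟨hx, q, hq⟩
    obtain rfl : x = fun i => (q i : ℝ) := funext hq
    obtain ⟨N, p, hN, hp, hpq⟩ := exists_isBalanced_of_rat hH ((hA _).2 hx)
    have hNR : (1 : ℝ) ≤ N := by exact_mod_cast hN
    -- The rational point is `N⁻¹ • p` with `N ≥ 1`, so it lies on the segment from 0 to `p`, whose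
    -- two ends are balanced.
    have h0 : (0 : I → ℝ) ∈ convexHull ℝ
        {x : I → ℝ | ∃ p : I → ℕ, IsBalanced (normalGraph H) p ∧ x = fun i => (p i : ℝ)} :=
      subset_convexHull ℝ _ ⟨fun _ => 0, IsBalanced.zero, by ext; simp⟩
    have h1 : (fun i => (p i : ℝ)) ∈ convexHull ℝ
        {x : I → ℝ | ∃ p : I → ℕ, IsBalanced (normalGraph H) p ∧ x = fun i => (p i : ℝ)} :=
      subset_convexHull ℝ _ ⟨p, hp, rfl⟩
    have := (convex_convexHull ℝ _).smul_mem_of_zero_mem h0 h1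
      (t := (N : ℝ)⁻¹) ⟨by positivity, inv_le_one_of_one_le₀ hNR⟩
    convert this using 1
    ext i
    rw [Pi.smul_apply, smul_eq_mul, hpq]
    field_simp

end Cone

end CycleCode

theorem mainTheorem2 {J I : Type*} [Fintype J] [Fintype I] [DecidableEq I]
    (H : Matrix J I (ZMod 2)) (hH : CycleCode.IsCycleCode H) :
    -- unscaled pseudo-codewords are the edge counts of combinations of cycles
    (∀ p : I → ℕ, CycleCode.IsUnscaledPseudoCodeword H p ↔
      ∃ Γ : Multiset (List I), (∀ γ ∈ Γ, CycleCode.IsBTCycle (CycleCode.normalGraph H) γ) ∧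
        ∀ i, p i = (Γ.map fun γ => γ.count i).sum) ∧
    -- a single cycle suffices exactly when the support is nonempty and connected
    (∀ p : I → ℕ,
      (CycleCode.IsUnscaledPseudoCodeword H p ∧
        CycleCode.IsConnectedEdgeSet (CycleCode.normalGraph H) {i | 0 < p i}) ↔
      ∃ γ : List I, CycleCode.IsBTCycle (CycleCode.normalGraph H) γ ∧ ∀ i, p i = γ.count i) ∧
    -- the product that defines the edge zeta function converges
    Multipliable (CycleCode.zetaFactor (CycleCode.normalGraph H)) ∧
    -- `p ↦ u ^ p` is a bijection from the unscaled pseudo-codewords to the monomials of `ζ_N`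
    Set.BijOn (fun p : I → ℕ => Finsupp.equivFunOnFinite.symm p)
      {p | CycleCode.IsUnscaledPseudoCodeword H p}
      {m | MvPowerSeries.coeff m (CycleCode.edgeZeta (CycleCode.normalGraph H)) ≠ 0} ∧
    -- the Newton polyhedron is the fundamental cone
    CycleCode.newtonPolyhedron (CycleCode.edgeZeta (CycleCode.normalGraph H)) =
      CycleCode.fundamentalCone H := by
  have hG := CycleCode.normalGraph_not_isLink_self H
  have hE := CycleCode.normalGraph_exists_isLink hH
  have hbal : ∀ p : I → ℕ, CycleCode.IsUnscaledPseudoCodeword H p ↔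
      CycleCode.IsBalanced (CycleCode.normalGraph H) p := fun p =>
    ⟨CycleCode.isBalanced_of_isUnscaledPseudoCodeword hH,
      CycleCode.isUnscaledPseudoCodeword_of_isBalanced hH⟩
  have hcoeff := CycleCode.coeff_edgeZeta_ne_zero_iff_isBalanced hG hE
  refine ⟨fun p => ?_, fun p => ?_, CycleCode.multipliable_zetaFactor, ⟨?_, ?_, ?_⟩, ?_⟩
  · rw [hbal]
    refine ⟨CycleCode.IsBalanced.exists_multiset hG hE _ p rfl, ?_⟩
    rintro ⟨Γ, hΓ, hp⟩
    obtain rfl := funext hp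
    exact CycleCode.IsBalanced.of_multiset hG Γ hΓ
  · rw [hbal]
    constructor
    · rintro ⟨hp, hconn⟩
      obtain ⟨Γ, hΓ, hpΓ⟩ := CycleCode.IsBalanced.exists_multiset hG hE _ p rfl hp
      obtain rfl := funext hpΓ
      exact CycleCode.exists_isBTCycle_of_connected hE _ Γ rfl hΓ hconn
    · rintro ⟨γ, hγ, hp⟩
      obtain rfl := funext hp
      exact ⟨hγ.isBalanced hG, hγ.isConnectedEdgeSet⟩
  · intro p hp
    exact (hcoeff _).2 ((hbal p).1 hp)
  · exact Finsupp.equivFunOnFinite.symm.injective.injOn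
  · intro m hm
    exact ⟨m, (hbal _).2 ((hcoeff m).1 hm), Finsupp.equivFunOnFinite.symm_apply_apply m⟩
  · rw [← CycleCode.convexHull_isBalanced_eq hH, CycleCode.newtonPolyhedron]
    congr 1
    ext x
    constructor
    · rintro ⟨m, hm, rfl⟩
      exact ⟨m, (hcoeff m).1 hm, rfl⟩
    · rintro ⟨p, hp, rfl⟩
      exact ⟨Finsupp.equivFunOnFinite.symm p, (hcoeff _).2 hp, rfl⟩
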